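/- **Lemma 5.1.** Let $\mathcal X,\mathcal Y$ be finite nonempty sets and $\ell\ge 0$ an integer, and let $\mathsf{Func}(\mathcal D,\mathcal Y)$ be the set of all functions $\mathcal D\to\mathcal Y$. Encode the elements of $\mathcal Y$ injectively as bit strings of some fixed length $m$; quantum access to $H:\{0,1\}^\ell\times\mathcal X\to\mathcal Y$ means access to the unitary $|u\rangle|y\rangle\mapsto|u\rangle|y\oplus H(u)\rangle$ for $u\in\{0,1\}^\ell\times\mathcal X$ and $y\in\{0,1\}^m$. Let $\mathcal A=(\mathcal A_1,\mathcal A_2)$ be any two-stage oracle-aided quantum algorithm: $\mathcal A_1$ has no input and outputs a (possibly mixed) state $|\mathsf{st}_{\mathcal A}\rangle$ of a finite-dimensional system, $\mathcal A_2$ receives $|\mathsf{st}_{\mathcal A}\rangle$ and a string $z\in\{0,1\}^\ell$ and outputs a bit; both work on finite-dimensional registers, may apply arbitrary quantum operations, including measurements whose outcomes control what is done next, and make finitely many quantum queries. Let $q_1$ be the maximal number of queries made by $\mathcal A_1$. For $z\in\{0,1\}^\ell$, $H:\{0,1\}^\ell\times\mathcal X\to\mathcal Y$ and $G:\mathcal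 X\to\mathcal Y$ define $$H[z,G](z',x)=\begin{cases}G(x)&\text{if } z'=z,\\ H(z',x)&\text{otherwise.}\end{cases}$$ Then $$\Bigl|\Pr\bigl[1\leftarrow\mathcal A_2^{H}(|\mathsf{st}_{\mathcal A}\rangle,z): |\mathsf{st}_{\mathcal A}\rangle\leftarrow\mathcal A_1^{H}()\bigr]-\Pr\bigl[1\leftarrow\mathcal A_2^{H[z,G]}(|\mathsf{st}_{\mathcal A}\rangle,z): |\mathsf{st}_{\mathcal A}\rangle\leftarrow\mathcal A_1^{H}()\bigr]\Bigr|\le q_1\,2^{-\frac{\ell}{2}+1},$$ where $z\in\{0,1\}^\ell$, $H\in\mathsf{Func}(\{0,1\}^\ell\times\mathcal X,\mathcal Y)$ and $G\in\mathsf{Func}(\mathcal X,\mathcal Y)$ are independent and uniformly random. -/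

import Mathlib

open scoped BigOperators Kronecker

noncomputable section

namespace QOracle

/-- Bit strings of length `n`. -/
abbrev BitString (n : ℕ) : Type := Fin n → Bool

/-- A quantum instrument from a system with computational basis `I` to a system with computational
basis `J`, with classical outcome in `C`, in Kraus form. The operators `kraus c k` (`k < r`) describe
the completely positive map applied when the outcome is `c`; all of them together are
trace preserving. -/
structure Instrument (C I J : Type*) [Fintype C] [Fintype I] [Fintype J] [DecidableEq I] where
  r : ℕ
  kraus : C → Fin r → Matrix J I ℂ
  complete : ∑ c, ∑ k, (kraus c k).conjTranspose * kraus c k = 1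

/-- The unnormalised state left by an instrument on outcome `c`; its trace is the probability of
the outcome `c`. -/
def Instrument.apply {C I J : Type*} [Fintype C] [Fintype I] [Fintype J] [DecidableEq I]
    (T : Instrument C I J) (c : C) (ρ : Matrix I I ℂ) : Matrix J J ℂ :=
  ∑ k, T.kraus c k * ρ * (T.kraus c k).conjTranspose

/-- A quantum channel (completely positive trace preserving map): an instrument with only one
outcome. -/
abbrev Channel (I J : Type*) [Fintype I] [Fintype J] [DecidableEq I] : Type _ :=
  Instrument Unit I J

/-- The effect of a channel on density matrices. -/
def Channel.map {I J : Type*} [Fintype I] [Fintype J] [DecidableEq I]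
    (T : Channel I J) (ρ : Matrix I I ℂ) : Matrix J J ℂ :=
  Instrument.apply T () ρ

/-- Computational basis of the registers of an oracle algorithm: a work register of dimension `w`,
a query register holding an element of the domain `D` of the oracle, and an answer register of
`m` qubits. -/
abbrev Reg (D : Type*) (m w : ℕ) : Type _ := Fin w × D × BitString m

/-- The program of an oracle algorithm with output system `O`. The program may stop and produce its
output by applying a channel to all registers, make one oracle query, or apply an arbitrary
instrument to all registers and continue in a way which depends on the classical outcome. With
one outcome the last constructor is an oracle-independent channel, e.g. a unitary gate. -/
inductive Program (D : Type*) [Fintype D] [DecidableEq D] (m w : ℕ)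
    (O : Type*) [Fintype O] where
  | halt (T : Channel (Reg D m w) O) : Program D m w O
  | query (next : Program D m w O) : Program D m w O
  | measure (C : ℕ) (T : Instrument (Fin C) (Reg D m w) (Reg D m w))
      (next : Fin C → Program D m w O) : Program D m w O

/-- The final state of the program with initial state `ρ`, when a query applies `U`; summation over
the outcomes averages over all computation paths. -/
def Program.run {D : Type*} [Fintype D] [DecidableEq D] {m w : ℕ} {O : Type*} [Fintype O]
    (U : Matrix (Reg D m w) (Reg D m w) ℂ) :
    Program D m w O → Matrix (Reg D m w) (Reg D m w) ℂ → Matrix O O ℂ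
  | .halt T, ρ => T.map ρ
  | .query next, ρ => next.run U (U * ρ * U.conjTranspose)
  | .measure _ T next, ρ => ∑ c, (next c).run U (T.apply c ρ)

/-- The maximal number of queries on a computation path. -/
def Program.maxQueries {D : Type*} [Fintype D] [DecidableEq D] {m w : ℕ} {O : Type*} [Fintype O] :
    Program D m w O → ℕ
  | .halt _ => 0
  | .query next => next.maxQueries + 1
  | .measure _ _ next => Finset.univ.sup fun c => (next c).maxQueries

/-- An oracle-aided quantum algorithm with input system `I` and output system `O`, with quantum
access to an oracle with domain `D` and answers of `m` bits: a work dimension, a channel that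
writes the input to the registers, and a program. -/
structure OracleAlgorithm (D : Type*) [Fintype D] [DecidableEq D] (m : ℕ)
    (I O : Type*) [Fintype I] [DecidableEq I] [Fintype O] where
  w : ℕ
  load : Channel I (Reg D m w)
  program : Program D m w O

/-- The unitary `|x⟩|y⟩ ↦ |x⟩|y ⊕ H(x)⟩` (identity on the work register), where the values of `H`
are written as bit strings by means of `enc`. -/
def oracleUnitary {D Y : Type*} [DecidableEq D] {m : ℕ} (w : ℕ)
    (enc : Y ↪ BitString m) (H : D → Y) : Matrix (Reg D m w) (Reg D m w) ℂ :=
  Matrix.of fun i j =>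
    if i = (j.1, j.2.1, fun t => Bool.xor (j.2.2 t) (enc (H j.2.1) t)) then 1 else 0

/-- The output state of an oracle algorithm with oracle `H` on the input state `ρ`. -/
def OracleAlgorithm.run {D Y : Type*} [Fintype D] [DecidableEq D] {m : ℕ}
    {I O : Type*} [Fintype I] [DecidableEq I] [Fintype O]
    (A : OracleAlgorithm D m I O) (enc : Y ↪ BitString m) (H : D → Y)
    (ρ : Matrix I I ℂ) : Matrix O O ℂ :=
  A.program.run (oracleUnitary A.w enc H) (A.load.map ρ)

/-- The maximal number of queries made by an oracle algorithm. -/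
def OracleAlgorithm.maxQueries {D : Type*} [Fintype D] [DecidableEq D] {m : ℕ}
    {I O : Type*} [Fintype I] [DecidableEq I] [Fintype O]
    (A : OracleAlgorithm D m I O) : ℕ :=
  A.program.maxQueries

/-- The function `H[z, G]`. -/
def reprogram {Z X Y : Type*} [DecidableEq Z] (H : Z × X → Y) (z : Z) (G : X → Y) : Z × X → Y :=
  fun p => if p.1 = z then G p.2 else H p

/-- The probability that `A₂`, with oracle `H₂` and input `(st, z)`, outputs `1`, where `st` is the
output state of `A₁` with oracle `H₁` and no input (that is, a one-dimensional input system). The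
output bit of `A₂` is obtained by measuring its output qubit in the computational basis. -/
def acceptProb {X Y S : Type*} [Fintype X] [DecidableEq X] [Fintype S] [DecidableEq S] {ℓ m : ℕ}
    (enc : Y ↪ BitString m)
    (A₁ : OracleAlgorithm (BitString ℓ × X) m Unit S)
    (A₂ : OracleAlgorithm (BitString ℓ × X) m (S × BitString ℓ) Bool)
    (H₁ H₂ : BitString ℓ × X → Y) (z : BitString ℓ) : ℝ :=
  (A₂.run enc H₂ (A₁.run enc H₁ 1 ⊗ₖ Matrix.single z z 1) true true).re

end QOracle

end

/-! For fixed `z`, exchanging `H(z, ·)` with `G` is a measure-preserving involution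
(`expect_reprogram_swap`), so in the second experiment one may run `A₁` with `H[z, G]` and `A₂` with
`H`. Now `H` and `G` can be fixed: `A₂` becomes a fixed effect for each `z`, and only `A₁` sees the
change.

The two oracle unitaries differ only on the range of the projection `P z` onto queries at `z`. By
`abs_trace_conj_sub_le`, changing one query on state `ρ` costs at most `t tr(P z ρ) + tr ρ / t`. In
the hybrid argument `Program.sum_abs_run_sub_le` this state comes from the run with `H`, hence does
not depend on `z`. As `∑ z, P z = 1`, summing over the `N = 2 ^ ℓ` strings with `t = √N` gives `2√N`
per query; averaging over `z` divides by `N`. -/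

namespace QOracle

open Matrix
open scoped ComplexOrder MatrixOrder

/-! ### Effects, the cost of one changed query, and the hybrid argument -/

section Effects

variable {I J : Type*} [Fintype I] [Fintype J] [DecidableEq I]

/-- An effect: a matrix `E` with `0 ≤ E ≤ 1`. -/
def IsEffect {I : Type*} [DecidableEq I] (E : Matrix I I ℂ) : Prop := E.PosSemidef ∧ (1 - E).PosSemidef

lemma IsEffect.sum_conj [DecidableEq J] {ι : Type*} [Fintype ι] {K : ι → Matrix J I ℂ}
    (hK : ∑ i, (K i)ᴴ * K i = 1) {E : ι → Matrix J J ℂ} (hE : ∀ i, IsEffect (E i)) :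
    IsEffect (∑ i, (K i)ᴴ * E i * K i) := by
  refine ⟨posSemidef_sum _ fun i _ => (hE i).1.conjTranspose_mul_mul_same _, ?_⟩
  have : 1 - ∑ i, (K i)ᴴ * E i * K i = ∑ i, (K i)ᴴ * (1 - E i) * K i := by
    rw [← hK, ← Finset.sum_sub_distrib]
    exact Finset.sum_congr rfl fun i _ => by rw [Matrix.mul_sub, Matrix.sub_mul, Matrix.mul_one]
  rw [this]
  exact posSemidef_sum _ fun i _ => (hE i).2.conjTranspose_mul_mul_same _

lemma IsEffect.conj [DecidableEq J] {V : Matrix J I ℂ} (hV : Vᴴ * V = 1) {E : Matrix J J ℂ} (hE : IsEffect E) :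
    IsEffect (Vᴴ * E * V) := by
  simpa using IsEffect.sum_conj (ι := Unit) (K := fun _ => V) (by simpa using hV) (fun _ => hE)

lemma isEffect_single {I : Type*} [DecidableEq I] (i : I) : IsEffect (single i i (1 : ℂ)) := by
  have h : single i i (1 : ℂ) = diagonal (Pi.single i 1) := by
    rw [diagonal_single]
  constructor
  · rw [h, posSemidef_diagonal_iff]
    intro j
    by_cases hj : j = i <;> simp [hj]
  · rw [h, ← diagonal_one, diagonal_sub, posSemidef_diagonal_iff]
    intro j
    by_cases hj : j = i <;> simp [hj]

lemma trace_single_mul (i : I) (M : Matrix I I ℂ) : (single i i (1 : ℂ) * M).trace = M i i := by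
  simp [Matrix.trace_single_mul]

lemma Instrument.exists_effect [DecidableEq J] {C : Type*} [Fintype C] (T : Instrument C I J)
    {E : C → Matrix J J ℂ} (hE : ∀ c, IsEffect (E c)) :
    ∃ F : Matrix I I ℂ, IsEffect F ∧ ∀ ρ, ∑ c, (E c * T.apply c ρ).trace = (F * ρ).trace := by
  refine ⟨_, IsEffect.sum_conj (ι := C × Fin T.r) (K := fun p => T.kraus p.1 p.2)
    (by rw [Fintype.sum_prod_type]; exact T.complete) (E := fun p => E p.1) (fun p => hE p.1), ?_⟩
  intro ρ
  rw [Matrix.sum_mul, trace_sum, Fintype.sum_prod_type]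
  refine Finset.sum_congr rfl fun c _ => ?_
  rw [Instrument.apply, Matrix.mul_sum, trace_sum]
  refine Finset.sum_congr rfl fun k _ => ?_
  rw [← Matrix.mul_assoc, trace_mul_comm]
  simp only [Matrix.mul_assoc]

lemma Instrument.sum_trace_apply {C : Type*} [Fintype C] (T : Instrument C I J)
    (ρ : Matrix I I ℂ) : ∑ c, (T.apply c ρ).trace = ρ.trace := by
  have h : ρ.trace = ((∑ c, ∑ k, (T.kraus c k)ᴴ * T.kraus c k) * ρ).trace := by
    rw [T.complete, Matrix.one_mul]
  rw [h, Matrix.sum_mul, trace_sum]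
  refine Finset.sum_congr rfl fun c _ => ?_
  rw [Instrument.apply, Matrix.sum_mul, trace_sum, trace_sum]
  refine Finset.sum_congr rfl fun k _ => ?_
  rw [trace_mul_comm, Matrix.mul_assoc]

lemma Instrument.posSemidef_apply {C : Type*} [Fintype C] (T : Instrument C I J) (c : C)
    {ρ : Matrix I I ℂ} (hρ : ρ.PosSemidef) : (T.apply c ρ).PosSemidef :=
  posSemidef_sum _ fun _ _ => hρ.mul_mul_conjTranspose_same _

/-- Heisenberg picture: pulling `E` back through the program condenses everything that follows a
query into one effect. -/
lemma Program.exists_effect [DecidableEq J] {D : Type*} [Fintype D] [DecidableEq D] {m w : ℕ}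
    {U : Matrix (Reg D m w) (Reg D m w) ℂ} (hU : Uᴴ * U = 1) {E : Matrix J J ℂ}
    (hE : IsEffect E) (A : Program D m w J) :
    ∃ F : Matrix (Reg D m w) (Reg D m w) ℂ, IsEffect F ∧
      ∀ ρ, (E * A.run U ρ).trace = (F * ρ).trace := by
  induction A with
  | halt T =>
    obtain ⟨F, hF, h⟩ := T.exists_effect (E := fun _ => E) (fun _ => hE)
    exact ⟨F, hF, fun ρ => by simpa [Program.run, Channel.map] using h ρ⟩
  | query next ih =>
    obtain ⟨F, hF, h⟩ := ih
    refine ⟨_, hF.conj hU, fun ρ => ?_⟩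
    rw [Program.run, h, ← Matrix.mul_assoc, trace_mul_comm]
    simp only [Matrix.mul_assoc]
  | measure C T next ih =>
    choose F hF h using ih
    obtain ⟨F', hF', h'⟩ := T.exists_effect hF
    refine ⟨F', hF', fun ρ => ?_⟩
    rw [Program.run, Matrix.mul_sum, trace_sum, ← h']
    exact Finset.sum_congr rfl fun c _ => h c _

lemma trace_mul_nonneg {W ρ : Matrix I I ℂ} (hW : W.PosSemidef) (hρ : ρ.PosSemidef) :
    0 ≤ (W * ρ).trace.re := by
  obtain ⟨B, rfl⟩ := CStarAlgebra.nonneg_iff_eq_star_mul_self.mp hρ.nonneg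
  rw [star_eq_conjTranspose]
  have h : (W * (Bᴴ * B)).trace = (B * W * Bᴴ).trace := by
    rw [← Matrix.mul_assoc, trace_mul_comm, ← Matrix.mul_assoc]
  rw [h]
  exact (Complex.le_def.mp (hW.mul_mul_conjTranspose_same B).trace_nonneg).1

/-- Two unitaries which agree off the projection `P` change the probability of an effect by at most
`t tr(Pρ) + t⁻¹ tr ρ`, here multiplied by `4 t`. -/
lemma trace_conj_sub_le {U V P E ρ : Matrix I I ℂ} (hU : Uᴴ * U = 1) (hV : Vᴴ * V = 1)
    (hP : Pᴴ = P) (hPP : P * P = P) (hUV : (U - V) * P = U - V) (hE : IsEffect E)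
    (hρ : ρ.PosSemidef) (t : ℝ) :
    4 * t * ((E * (U * ρ * Uᴴ)).trace.re - (E * (V * ρ * Vᴴ)).trace.re) ≤
      4 * t ^ 2 * (P * ρ).trace.re + 4 * ρ.trace.re := by
  -- Parallelogram law for two isometries.
  have hpar : (U - V)ᴴ * (U - V) = (4 : ℂ) • 1 - (U + V)ᴴ * (U + V) := by
    have : (4 : ℂ) • (1 : Matrix I I ℂ) = (2 : ℂ) • (Uᴴ * U) + (2 : ℂ) • (Vᴴ * V) := by
      rw [hU, hV, ← add_smul]; norm_num
    rw [this, conjTranspose_sub, conjTranspose_add]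
    simp only [Matrix.mul_add, Matrix.add_mul, Matrix.mul_sub, Matrix.sub_mul]
    module
  have hD : (U - V)ᴴ * (U - V) = (4 : ℂ) • P - ((U + V) * P)ᴴ * ((U + V) * P) := by
    have h : (U - V)ᴴ * (U - V) = P * ((U - V)ᴴ * (U - V)) * P := by
      conv_lhs => rw [← hUV, conjTranspose_mul, hP]
      simp only [Matrix.mul_assoc]
    rw [h, hpar, conjTranspose_mul, hP]
    simp only [Matrix.mul_sub, Matrix.sub_mul, Matrix.mul_smul, Matrix.smul_mul, Matrix.mul_one,
      hPP, Matrix.mul_assoc]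
  -- A sum-of-squares certificate in place of Cauchy–Schwarz: pairing this positive matrix with `ρ`
  -- is exactly the claim.
  have hW : (((t : ℂ) • (U - V) - (U + V))ᴴ * E * ((t : ℂ) • (U - V) - (U + V)) +
      ((t : ℂ) • (U - V) + (U + V))ᴴ * (1 - E) * ((t : ℂ) • (U - V) + (U + V)) +
      ((t : ℂ) • ((U + V) * P))ᴴ * ((t : ℂ) • ((U + V) * P)) + (U - V)ᴴ * (U - V)).PosSemidef :=
    (((hE.1.conjTranspose_mul_mul_same _).add (hE.2.conjTranspose_mul_mul_same _)).add
      (posSemidef_conjTranspose_mul_self _)).add (posSemidef_conjTranspose_mul_self _)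
  have hWeq : ((t : ℂ) • (U - V) - (U + V))ᴴ * E * ((t : ℂ) • (U - V) - (U + V)) +
      ((t : ℂ) • (U - V) + (U + V))ᴴ * (1 - E) * ((t : ℂ) • (U - V) + (U + V)) +
      ((t : ℂ) • ((U + V) * P))ᴴ * ((t : ℂ) • ((U + V) * P)) + (U - V)ᴴ * (U - V) =
      ((4 * t ^ 2 : ℝ) : ℂ) • P + ((4 : ℝ) : ℂ) • (1 : Matrix I I ℂ)
        - ((4 * t : ℝ) : ℂ) • (Uᴴ * E * U - Vᴴ * E * V) := by
    have hQ : ((t : ℂ) • ((U + V) * P))ᴴ * ((t : ℂ) • ((U + V) * P)) =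
        (t ^ 2 : ℂ) • ((4 : ℂ) • P - (U - V)ᴴ * (U - V)) := by
      rw [hD, conjTranspose_smul, Matrix.smul_mul, Matrix.mul_smul, smul_smul, sub_sub_cancel]
      simp [pow_two]
    rw [hQ]
    have h4 : ((4 : ℝ) : ℂ) • (1 : Matrix I I ℂ) = (2 : ℂ) • (Uᴴ * U) + (2 : ℂ) • (Vᴴ * V) := by
      rw [hU, hV, ← add_smul]; norm_num
    -- The cross terms free of `E` add up to this difference, which vanishes because both are
    -- isometries; `module` needs it spelled out.
    have h0 : (2 * t : ℂ) • (Uᴴ * U) - (2 * t : ℂ) • (Vᴴ * V) = 0 := by rw [hU, hV, sub_self]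
    rw [h4, ← sub_eq_zero, ← h0]
    simp only [conjTranspose_sub, conjTranspose_add, conjTranspose_smul, Complex.star_def,
      Complex.conj_ofReal, Matrix.mul_add, Matrix.add_mul, Matrix.mul_sub, Matrix.sub_mul,
      Matrix.smul_mul, Matrix.mul_smul, Matrix.mul_one, Complex.ofReal_mul, Complex.ofReal_pow,
      Complex.ofReal_ofNat]
    module
  rw [hWeq] at hW
  have h := trace_mul_nonneg hW hρ
  have hc : ∀ X : Matrix I I ℂ, (Xᴴ * E * X * ρ).trace = (E * (X * ρ * Xᴴ)).trace := by
    intro X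
    rw [← Matrix.mul_assoc, trace_mul_comm (E * (X * ρ))]
    simp only [Matrix.mul_assoc]
  simp only [Matrix.sub_mul, Matrix.add_mul, Matrix.smul_mul, trace_sub, trace_add, trace_smul,
    smul_eq_mul, Complex.sub_re, Complex.add_re, Complex.re_ofReal_mul, hc, Matrix.one_mul] at h
  linarith

lemma abs_trace_conj_sub_le {U V P E ρ : Matrix I I ℂ} (hU : Uᴴ * U = 1) (hV : Vᴴ * V = 1)
    (hP : Pᴴ = P) (hPP : P * P = P) (hUV : (U - V) * P = U - V) (hE : IsEffect E)
    (hρ : ρ.PosSemidef) {t : ℝ} (ht : 0 < t) :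
    |(E * (U * ρ * Uᴴ)).trace.re - (E * (V * ρ * Vᴴ)).trace.re| ≤
      t * (P * ρ).trace.re + ρ.trace.re / t := by
  have h₁ := trace_conj_sub_le hU hV hP hPP hUV hE hρ t
  have h₂ := trace_conj_sub_le hV hU hP hPP
    (by rw [← neg_sub U V, Matrix.neg_mul, hUV]) hE hρ t
  have key : ∀ d p r : ℝ, 4 * t * d ≤ 4 * t ^ 2 * p + 4 * r → d ≤ t * p + r / t := by
    intro d p r h
    have : t * p + r / t - d = (4 * t ^ 2 * p + 4 * r - 4 * t * d) / (4 * t) := by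
      field_simp
    have : 0 ≤ t * p + r / t - d := this ▸ div_nonneg (by linarith) (by linarith)
    linarith
  rw [abs_le']
  exact ⟨key _ _ _ h₁, by rw [neg_sub]; exact key _ _ _ h₂⟩

/-- The hybrid argument: if `V z` agrees with `U` off the projection `P z` and the projections sum
to `1`, then running a program with `V z` instead of `U` has a small effect for most `z`. -/
lemma Program.sum_abs_run_sub_le [DecidableEq J] {D : Type*} [Fintype D] [DecidableEq D] {m w : ℕ}
    {Z : Type*} [Fintype Z] [Nonempty Z]
    {U : Matrix (Reg D m w) (Reg D m w) ℂ} {V P : Z → Matrix (Reg D m w) (Reg D m w) ℂ}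
    (hU : Uᴴ * U = 1) (hV : ∀ z, (V z)ᴴ * V z = 1) (hP : ∀ z, (P z)ᴴ = P z)
    (hPP : ∀ z, P z * P z = P z) (hsum : ∑ z, P z = 1)
    (hUV : ∀ z, (U - V z) * P z = U - V z) {E : Z → Matrix J J ℂ} (hE : ∀ z, IsEffect (E z))
    (A : Program D m w J) {ρ : Matrix (Reg D m w) (Reg D m w) ℂ} (hρ : ρ.PosSemidef) :
    ∑ z, |(E z * A.run U ρ).trace.re - (E z * A.run (V z) ρ).trace.re| ≤
      A.maxQueries * (2 * √(Fintype.card Z)) * ρ.trace.re := by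
  induction A generalizing ρ with
  | halt T => simp [Program.run, Program.maxQueries]
  | query next ih =>
    set N : ℝ := (Fintype.card Z : ℝ) with hN
    have hN0 : 0 < N := by rw [hN]; exact_mod_cast Fintype.card_pos
    have hs : 0 < √N := Real.sqrt_pos.mpr hN0
    -- `F z` is the rest of the program, already run with `V z`. The intermediate hybrid makes this
    -- query with `U` and the later ones with `V z`.
    choose F hF hFt using fun z => next.exists_effect (hV z) (hE z)
    have h₁ := ih (hρ.mul_mul_conjTranspose_same U)
    have htr : (U * ρ * Uᴴ).trace = ρ.trace := by
      rw [trace_mul_comm, ← Matrix.mul_assoc, hU, Matrix.one_mul]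
    rw [htr] at h₁
    have h₂ : ∑ z, |(F z * (U * ρ * Uᴴ)).trace.re - (F z * (V z * ρ * (V z)ᴴ)).trace.re| ≤
        2 * √N * ρ.trace.re := by
      -- `t = √N` balances the total query weight `t tr ρ` against `N tr ρ / t`.
      calc _ ≤ ∑ z, (√N * (P z * ρ).trace.re + ρ.trace.re / √N) :=
            Finset.sum_le_sum fun z _ =>
              abs_trace_conj_sub_le hU (hV z) (hP z) (hPP z) (hUV z) (hF z) hρ hs
        _ = √N * ρ.trace.re + N * (ρ.trace.re / √N) := by
            rw [Finset.sum_add_distrib, ← Finset.mul_sum, ← Complex.re_sum, ← trace_sum,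
              ← Matrix.sum_mul, hsum, Matrix.one_mul, Finset.sum_const, Finset.card_univ,
              nsmul_eq_mul]
        _ = 2 * √N * ρ.trace.re := by
            have : N = √N * √N := (Real.mul_self_sqrt hN0.le).symm
            field_simp
            rw [Real.sq_sqrt hN0.le]
            ring
    calc _ ≤ ∑ z, (|(E z * next.run U (U * ρ * Uᴴ)).trace.re -
              (E z * next.run (V z) (U * ρ * Uᴴ)).trace.re| +
            |(F z * (U * ρ * Uᴴ)).trace.re - (F z * (V z * ρ * (V z)ᴴ)).trace.re|) := by
          refine Finset.sum_le_sum fun z _ => ?_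
          rw [← hFt, ← hFt, Program.run, Program.run]
          exact abs_sub_le _ _ _
      _ ≤ next.maxQueries * (2 * √N) * ρ.trace.re + 2 * √N * ρ.trace.re := by
          rw [Finset.sum_add_distrib]
          exact add_le_add h₁ h₂
      _ = _ := by
          rw [Program.maxQueries]
          push_cast
          ring
  | measure C T next ih =>
    calc _ ≤ ∑ z, ∑ c, |(E z * (next c).run U (T.apply c ρ)).trace.re -
            (E z * (next c).run (V z) (T.apply c ρ)).trace.re| := by
          refine Finset.sum_le_sum fun z _ => ?_
          simp only [Program.run, Matrix.mul_sum, trace_sum, Complex.re_sum]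
          rw [← Finset.sum_sub_distrib]
          exact Finset.abs_sum_le_sum_abs _ _
      _ ≤ ∑ c, ((Program.measure C T next).maxQueries * (2 * √(Fintype.card Z))) *
            (T.apply c ρ).trace.re := by
          rw [Finset.sum_comm]
          refine Finset.sum_le_sum fun c _ => ?_
          have hpos := T.posSemidef_apply c hρ
          refine (ih c hpos).trans ?_
          have htr : 0 ≤ (T.apply c ρ).trace.re := (Complex.le_def.mp hpos.trace_nonneg).1
          have hq : (next c).maxQueries ≤ (Program.measure C T next).maxQueries :=
            Finset.le_sup (f := fun c => (next c).maxQueries) (Finset.mem_univ c)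
          gcongr
      _ = _ := by
          -- Branches are left unnormalised, so their bounds add up to the one for `ρ`.
          rw [← Finset.mul_sum, ← Complex.re_sum, T.sum_trace_apply]

end Effects

/-! ### Oracle unitaries, the second stage as an effect, and resampling -/

section Oracle

variable {X Y : Type*} [DecidableEq X] {ℓ m : ℕ}

lemma conjTranspose_mul_self_of_injective {I : Type*} [Fintype I] [DecidableEq I] {f : I → I}
    (hf : Function.Injective f) :
    (Matrix.of fun i j => if i = f j then (1 : ℂ) else 0)ᴴ *
      (Matrix.of fun i j => if i = f j then (1 : ℂ) else 0) = 1 := by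
  ext i j
  simp [Matrix.mul_apply, Matrix.one_apply, hf.eq_iff, eq_comm]

lemma oracleUnitary_unitary {D : Type*} [Fintype D] [DecidableEq D] (w : ℕ) (enc : Y ↪ BitString m)
    (H : D → Y) : (oracleUnitary w enc H)ᴴ * oracleUnitary w enc H = 1 := by
  refine conjTranspose_mul_self_of_injective
    (f := fun j : Reg D m w => (j.1, j.2.1, fun t => Bool.xor (j.2.2 t) (enc (H j.2.1) t))) ?_
  rintro ⟨a, x, y⟩ ⟨b, x', y'⟩ h
  simp only [Prod.mk.injEq] at h
  obtain ⟨rfl, rfl, h⟩ := h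
  have : y = y' := funext fun t => by simpa using congrFun h t
  rw [this]

/-- The projection onto the queries at points with first component `z`. -/
def queryProj (X : Type*) [DecidableEq X] (ℓ m w : ℕ) (z : BitString ℓ) :
    Matrix (Reg (BitString ℓ × X) m w) (Reg (BitString ℓ × X) m w) ℂ :=
  diagonal fun i => if i.2.1.1 = z then 1 else 0

lemma queryProj_conjTranspose (w : ℕ) (z : BitString ℓ) :
    (queryProj X ℓ m w z)ᴴ = queryProj X ℓ m w z := by
  rw [queryProj, diagonal_conjTranspose]
  congr 1
  ext i
  by_cases h : i.2.1.1 = z <;> simp [h]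

lemma queryProj_mul_self [Fintype X] (w : ℕ) (z : BitString ℓ) :
    queryProj X ℓ m w z * queryProj X ℓ m w z = queryProj X ℓ m w z := by
  rw [queryProj, diagonal_mul_diagonal]
  congr 1
  ext i
  by_cases h : i.2.1.1 = z <;> simp [h]

lemma sum_queryProj (w : ℕ) : ∑ z, queryProj X ℓ m w z = 1 := by
  ext i j
  rw [Matrix.sum_apply]
  by_cases h : i = j
  · subst h
    simp [queryProj]
  · simp [queryProj, h]

/-- Right multiplication by the projection keeps the columns with query at `z`; in all others the
two oracles agree. -/
lemma oracleUnitary_sub_mul_queryProj [Fintype X] (w : ℕ) (enc : Y ↪ BitString m) (H : BitString ℓ × X → Y)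
    (z : BitString ℓ) (G : X → Y) :
    (oracleUnitary w enc H - oracleUnitary w enc (reprogram H z G)) * queryProj X ℓ m w z =
      oracleUnitary w enc H - oracleUnitary w enc (reprogram H z G) := by
  ext i j
  rw [queryProj, mul_diagonal]
  by_cases h : j.2.1.1 = z
  · simp [h]
  · simp [h, oracleUnitary, reprogram]

/-- The second stage, for a fixed oracle and a fixed string `z`, is an effect on the intermediate
state. -/
lemma exists_effect_acceptProb [Fintype X] {S : Type*} [Fintype S] [DecidableEq S] (enc : Y ↪ BitString m)
    (A₂ : OracleAlgorithm (BitString ℓ × X) m (S × BitString ℓ) Bool)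
    (H₂ : BitString ℓ × X → Y) (z : BitString ℓ) :
    ∃ F : Matrix S S ℂ, IsEffect F ∧
      ∀ (A₁ : OracleAlgorithm (BitString ℓ × X) m Unit S) (H₁ : BitString ℓ × X → Y),
        acceptProb enc A₁ A₂ H₁ H₂ z = (F * A₁.run enc H₁ 1).trace.re := by
  obtain ⟨F₁, hF₁, h₁⟩ := A₂.program.exists_effect (oracleUnitary_unitary A₂.w enc H₂)
    (isEffect_single true)
  obtain ⟨F₂, hF₂, h₂⟩ := A₂.load.exists_effect (E := fun _ => F₁) (fun _ => hF₁)
  -- The isometry that appends the basis state `z`.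
  let V : Matrix (S × BitString ℓ) S ℂ := Matrix.of fun p s => if p = (s, z) then 1 else 0
  have hV : Vᴴ * V = 1 := by
    ext s s'
    simp [V, Matrix.mul_apply, Matrix.one_apply, eq_comm]
  have hVσ : ∀ σ : Matrix S S ℂ, σ ⊗ₖ single z z 1 = V * σ * Vᴴ := by
    intro σ
    ext ⟨s, y⟩ ⟨s', y'⟩
    by_cases hy : y = z <;> by_cases hy' : y' = z <;>
      simp [V, Matrix.mul_apply, hy, hy', Ne.symm]
  refine ⟨_, hF₂.conj hV, fun A₁ H₁ => ?_⟩
  change (A₂.program.run (oracleUnitary A₂.w enc H₂)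
    (A₂.load.apply () (A₁.run enc H₁ 1 ⊗ₖ single z z 1)) true true).re = _
  refine (congrArg Complex.re ((trace_single_mul true _).symm.trans (h₁ _))).trans ?_
  have h := h₂ (A₁.run enc H₁ 1 ⊗ₖ single z z 1)
  simp only [Finset.univ_unique, Finset.sum_singleton] at h
  rw [h, hVσ, ← Matrix.mul_assoc, trace_mul_comm]
  simp only [Matrix.mul_assoc]

lemma expect_abs_acceptProb_sub_le [Fintype X] {S : Type*} [Fintype S] [DecidableEq S] (enc : Y ↪ BitString m)
    (A₁ : OracleAlgorithm (BitString ℓ × X) m Unit S)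
    (A₂ : OracleAlgorithm (BitString ℓ × X) m (S × BitString ℓ) Bool)
    (H : BitString ℓ × X → Y) (G : X → Y) :
    𝔼 z : BitString ℓ, |acceptProb enc A₁ A₂ H H z -
        acceptProb enc A₁ A₂ (reprogram H z G) H z| ≤
      (A₁.maxQueries : ℝ) * (2 : ℝ) ^ (-(ℓ : ℝ) / 2 + 1) := by
  choose F hF hFt using exists_effect_acceptProb enc A₂ H
  have h1 : (1 : Matrix Unit Unit ℂ).PosSemidef := PosSemidef.one
  have hρ : (A₁.load.map 1).PosSemidef := A₁.load.posSemidef_apply () h1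
  have htr : (A₁.load.map 1).trace = 1 := by
    simpa [Channel.map] using A₁.load.sum_trace_apply (1 : Matrix Unit Unit ℂ)
  have h := A₁.program.sum_abs_run_sub_le (Z := BitString ℓ)
    (oracleUnitary_unitary A₁.w enc H)
    (fun z => oracleUnitary_unitary A₁.w enc (reprogram H z G))
    (fun z => queryProj_conjTranspose A₁.w z) (fun z => queryProj_mul_self A₁.w z)
    (sum_queryProj A₁.w) (fun z => oracleUnitary_sub_mul_queryProj A₁.w enc H z G) hF hρ
  rw [htr, Complex.one_re, mul_one] at h
  have hcard : (Fintype.card (BitString ℓ) : ℝ) = (2 : ℝ) ^ (ℓ : ℝ) := by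
    simp [BitString]
  rw [Fintype.expect_eq_sum_div_card]
  simp only [hFt]
  rw [div_le_iff₀ (by rw [hcard]; positivity)]
  refine h.trans (le_of_eq ?_)
  rw [OracleAlgorithm.maxQueries, hcard, mul_assoc, Real.sqrt_eq_rpow,
    ← Real.rpow_mul (by norm_num), ← Real.rpow_add (by norm_num)]
  nth_rewrite 1 [← Real.rpow_one 2]
  rw [← Real.rpow_add (by norm_num)]
  congr 2
  ring

/-- Exchanging the values of `H` at `z` with `G`. -/
def reprogramEquiv {Z : Type*} [DecidableEq Z] (z : Z) :
    (Z × X → Y) × (X → Y) ≃ (Z × X → Y) × (X → Y) :=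
  Function.Involutive.toPerm (fun p => (reprogram p.1 z p.2, fun x => p.1 (z, x))) <| by
    rintro ⟨H, G⟩
    simp only [Prod.mk.injEq]
    constructor
    · funext ⟨z', x⟩
      by_cases h : z' = z <;> simp [reprogram, h]
    · funext x
      simp [reprogram]

/-- The pair `(H, G)` is uniform, and `reprogramEquiv z` exchanges `H` with `reprogram H z G`. -/
lemma expect_reprogram_swap [Fintype X] [Fintype Y] {Z : Type*} [Fintype Z] [DecidableEq Z] (z : Z)
    (f : (Z × X → Y) → (Z × X → Y) → ℝ) :
    (𝔼 H : Z × X → Y, 𝔼 G : X → Y, f H (reprogram H z G)) =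
      𝔼 H : Z × X → Y, 𝔼 G : X → Y, f (reprogram H z G) H := by
  rw [← Finset.expect_product' (f := fun H G => f H (reprogram H z G)),
    ← Finset.expect_product' (f := fun H G => f (reprogram H z G) H), Finset.univ_product_univ]
  refine Fintype.expect_equiv (reprogramEquiv z) _ _ fun p => ?_
  have h : reprogram (reprogramEquiv z p).1 z (reprogramEquiv z p).2 = p.1 :=
    congrArg Prod.fst ((reprogramEquiv z).left_inv p)
  rw [h]
  rfl

end Oracle

end QOracle

theorem lemma5p1 {X Y S : Type*} [Fintype X] [DecidableEq X] [Fintype Y]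
    [Fintype S] [DecidableEq S] {ℓ m : ℕ}
    (enc : Y ↪ QOracle.BitString m)
    (A₁ : QOracle.OracleAlgorithm (QOracle.BitString ℓ × X) m Unit S)
    (A₂ : QOracle.OracleAlgorithm (QOracle.BitString ℓ × X) m (S × QOracle.BitString ℓ) Bool) :
    |(𝔼 z : QOracle.BitString ℓ, 𝔼 H : QOracle.BitString ℓ × X → Y,
        QOracle.acceptProb enc A₁ A₂ H H z) -
      (𝔼 z : QOracle.BitString ℓ, 𝔼 H : QOracle.BitString ℓ × X → Y, 𝔼 G : X → Y,
        QOracle.acceptProb enc A₁ A₂ H (QOracle.reprogram H z G) z)| ≤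
      (A₁.maxQueries : ℝ) * (2 : ℝ) ^ (-(ℓ : ℝ) / 2 + 1) := by

  set B : ℝ := (A₁.maxQueries : ℝ) * (2 : ℝ) ^ (-(ℓ : ℝ) / 2 + 1) with hB
  have hB0 : 0 ≤ B := by positivity
  -- Without any functions `H` both averages are `0` by convention.
  rcases isEmpty_or_nonempty (QOracle.BitString ℓ × X → Y) with hH | ⟨⟨H₀⟩⟩
  · simpa using hB0
  have : Nonempty (QOracle.BitString ℓ × X → Y) := ⟨H₀⟩
  have : Nonempty (X → Y) := ⟨fun x => H₀ (fun _ => false, x)⟩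
  have h : (𝔼 z : QOracle.BitString ℓ, 𝔼 H : QOracle.BitString ℓ × X → Y,
        QOracle.acceptProb enc A₁ A₂ H H z) -
      (𝔼 z : QOracle.BitString ℓ, 𝔼 H : QOracle.BitString ℓ × X → Y, 𝔼 G : X → Y,
        QOracle.acceptProb enc A₁ A₂ H (QOracle.reprogram H z G) z) =
      𝔼 H : QOracle.BitString ℓ × X → Y, 𝔼 G : X → Y, 𝔼 z : QOracle.BitString ℓ,
        (QOracle.acceptProb enc A₁ A₂ H H z -
          QOracle.acceptProb enc A₁ A₂ (QOracle.reprogram H z G) H z) := by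
    calc _ = 𝔼 z : QOracle.BitString ℓ, 𝔼 H : QOracle.BitString ℓ × X → Y, 𝔼 G : X → Y,
          (QOracle.acceptProb enc A₁ A₂ H H z -
            QOracle.acceptProb enc A₁ A₂ (QOracle.reprogram H z G) H z) := by
          rw [← Finset.expect_sub_distrib]
          refine Finset.expect_congr rfl fun z _ => ?_
          rw [QOracle.expect_reprogram_swap z fun H₁ H₂ => QOracle.acceptProb enc A₁ A₂ H₁ H₂ z,
            ← Finset.expect_sub_distrib]
          refine Finset.expect_congr rfl fun H _ => ?_
          rw [Finset.expect_sub_distrib, Fintype.expect_const]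
      _ = _ := by
          -- The average over `z` moves innermost, since the hybrid bound holds for each fixed `H`
          -- and `G`.
          rw [Finset.expect_comm]
          exact Finset.expect_congr rfl fun H _ => Finset.expect_comm _ _ _
  rw [h]
  refine (Finset.abs_expect_le _ _).trans (Finset.expect_le Finset.univ_nonempty fun H _ => ?_)
  refine (Finset.abs_expect_le _ _).trans (Finset.expect_le Finset.univ_nonempty fun G _ => ?_)
  exact (Finset.abs_expect_le _ _).trans (QOracle.expect_abs_acceptProb_sub_le enc A₁ A₂ H G)
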